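/- Let $(a_n)_{n\geq 1}$ be a strictly increasing sequence of positive integers and let $0<\beta<1$. Then for Lebesgue-almost every $x\in[0,1]$ the sequence $(a_n x)_{n\geq 1}$, taken modulo $1$, has Poissonian $\beta$-pair correlations, that is, $$\lim_{N\to\infty}\frac{1}{N^{2-\beta}}\,\#\Big\{(m,n) : 1\leq m,n\leq N,\ m\neq n,\ \|a_m x-a_n x\|\leq \frac{s}{N^{\beta}}\Big\}=2s\qquad\text{for all } s>0,$$ where $\|y\|=\min_{k\in\mathbb{Z}}|y-k|$ denotes the distance of $y\in\mathbb{R}$ to the nearest integer. -/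

import Mathlib

open MeasureTheory Filter Topology

/-- The distance of a real number `x` to the nearest integer. -/
noncomputable def distNearestInt (x : ℝ) : ℝ := |x - round x|

/-- `distNearestInt x` is the minimum of `|x - k|` over all integers `k`. -/
theorem distNearestInt_isLeast (x : ℝ) :
    IsLeast (Set.range fun k : ℤ => |x - (k : ℝ)|) (distNearestInt x) :=
  ⟨⟨round x, rfl⟩, by rintro _ ⟨k, rfl⟩; exact round_le x k⟩

/-- The pair correlation function `R₂(β; s, N)` with parameter `β` of a sequence
`x 1, x 2, x 3, …` of points modulo one (the value `x 0` is not used):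
`N ^ (-(2 - β))` times the number of ordered pairs `(m, n)` of distinct indices
in `{1, …, N}` with `‖x m - x n‖ ≤ s / N ^ β`.
Only the values of `x` modulo one matter. -/
noncomputable def pairCorrelation (x : ℕ → ℝ) (β s : ℝ) (N : ℕ) : ℝ :=
  1 / (N : ℝ) ^ (2 - β) *
    (((Finset.Icc 1 N ×ˢ Finset.Icc 1 N).filter fun p : ℕ × ℕ =>
      p.1 ≠ p.2 ∧ distNearestInt (x p.1 - x p.2) ≤ s / (N : ℝ) ^ β).card : ℝ)

/-- The sequence `x 1, x 2, …` has Poissonian `β`-pair correlations (for `0 < β`). -/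
def HasPoissonianPairCorrelations (β : ℝ) (x : ℕ → ℝ) : Prop :=
  ∀ s : ℝ, 0 < s → Tendsto (fun N : ℕ => pairCorrelation x β s N) atTop (𝓝 (2 * s))

/-! This is a second-moment argument. Counting close pairs at scale `δ = s / N ^ β` sums indicators
of `‖d x‖ ≤ δ` over the `N ^ 2 - N` differences `d = |a m - a n|`. Its mean is exactly `2 δ (N ^ 2 -
N)`, and two indicators with frequencies `d`, `e` have covariance at most `2 δ gcd(d, e) / max(d,
e)` (`integral_nearIntIndicator_mul_le_max`). The variance is thus controlled by a GCD sum weighted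
by the multiplicities of the differences. Such a sum over a set `D` is at most `C |D| ^ ε` times the
sum of squared weights (`exists_sum_gcd_div_max_le`). This comes from composing the kernel `(gcd² /
(d e)) ^ σ`, `σ > 1/2`, with itself and iterating Cauchy–Schwarz. Each difference has multiplicity
at most `2 N`, so the normalised variance is `O(N ^ (β - 1 + ε))`, a negative power for small `ε`.
Along `N = (j + 1) ^ L` with `L` large these variances are summable, which gives almost sure
convergence for all rational `s` simultaneously. Monotonicity of the count in `N` and `δ` fills in
the other `N` and real `s` (`tendsto_pairCorrelation_of_subsequence`). -/

/-! ### Divisor estimates -/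

/-- Compare Euler factors `a + 1` and `p ^ (a ε)`: primes with `p ^ ε ≥ 2` cost nothing, and each of
the fewer than `P + 1` smaller ones costs at most a constant `c`. -/
theorem exists_card_divisors_le_mul_rpow {ε : ℝ} (hε : 0 < ε) :
    ∃ C : ℝ, 0 < C ∧ ∀ n : ℕ, (n.divisors.card : ℝ) ≤ C * (n : ℝ) ^ ε := by
  obtain ⟨P, hP⟩ := exists_nat_gt ((2 : ℝ) ^ (1 / ε))
  -- Chosen so that `a + 1 ≤ c (1 + a ε log 2) ≤ c 2 ^ (a ε)`.
  set c : ℝ := max 1 (1 / (ε * Real.log 2)) with hc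
  have hc1 : 1 ≤ c := le_max_left _ _
  have hlog : 0 < Real.log 2 := Real.log_pos (by norm_num)
  have hc2 : 1 ≤ c * (ε * Real.log 2) := by
    have : 1 / (ε * Real.log 2) ≤ c := le_max_right _ _
    rwa [div_le_iff₀ (by positivity)] at this
  refine ⟨c ^ P, by positivity, fun n => ?_⟩
  rcases eq_or_ne n 0 with rfl | hn
  · simp [Real.zero_rpow hε.ne']
  have key : ∀ p ∈ n.primeFactors, ((n.factorization p + 1 : ℕ) : ℝ) ≤
      (if p < P then c else 1) * ((p : ℝ) ^ n.factorization p) ^ ε := by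
    intro p hp
    have hp2 : (2 : ℝ) ≤ p := by exact_mod_cast (Nat.prime_of_mem_primeFactors hp).two_le
    set a := n.factorization p
    have hpow : ((p : ℝ) ^ a) ^ ε = ((p : ℝ) ^ ε) ^ a := by
      rw [← Real.rpow_natCast, ← Real.rpow_natCast, ← Real.rpow_mul (by positivity),
        ← Real.rpow_mul (by positivity), mul_comm]
    rw [hpow]
    split_ifs with h
    · have h1 : 1 + a * (ε * Real.log 2) ≤ ((p : ℝ) ^ ε) ^ a := by
        calc 1 + a * (ε * Real.log 2) ≤ Real.exp (a * (ε * Real.log 2)) := by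
              linarith [Real.add_one_le_exp (a * (ε * Real.log 2))]
          _ = ((2 : ℝ) ^ ε) ^ a := by
              rw [Real.exp_nat_mul, Real.rpow_def_of_pos (by norm_num), mul_comm ε]
          _ ≤ _ := by gcongr
      have ha : (0 : ℝ) ≤ a := Nat.cast_nonneg a
      push_cast
      nlinarith [mul_le_mul_of_nonneg_left hc2 ha, mul_le_mul_of_nonneg_left h1 (by linarith : 0 ≤ c)]
    · have h2 : (2 : ℝ) ≤ (p : ℝ) ^ ε := by
        have hle : (2 : ℝ) ^ (1 / ε) ≤ p := hP.le.trans (by exact_mod_cast not_lt.mp h)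
        calc (2 : ℝ) = ((2 : ℝ) ^ (1 / ε)) ^ ε := by
              rw [← Real.rpow_mul (by norm_num), one_div_mul_cancel hε.ne', Real.rpow_one]
          _ ≤ _ := by gcongr
      rw [one_mul]
      calc ((a + 1 : ℕ) : ℝ) ≤ (2 : ℝ) ^ a := by exact_mod_cast Nat.lt_two_pow_self
        _ ≤ _ := by gcongr
  rw [Nat.card_divisors hn, Nat.cast_prod]
  calc _ ≤ ∏ p ∈ n.primeFactors, (if p < P then c else 1) * ((p : ℝ) ^ n.factorization p) ^ ε :=
        Finset.prod_le_prod (fun _ _ => by positivity) key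
    _ = (∏ p ∈ n.primeFactors, if p < P then c else 1) * (n : ℝ) ^ ε := by
        rw [Finset.prod_mul_distrib, Real.finsetProd_rpow _ _ (fun _ _ => by positivity)]
        congr 2
        conv_rhs => rw [← Nat.prod_factorization_pow_eq_self hn]
        simp [Finsupp.prod]
    _ ≤ _ := by
        gcongr
        rw [Finset.prod_ite, Finset.prod_const, Finset.prod_const_one, mul_one]
        refine pow_le_pow_right₀ hc1 ?_
        calc _ ≤ (Finset.range P).card := Finset.card_le_card (fun p hp => by
              simpa using (Finset.mem_filter.mp hp).2)
          _ = P := Finset.card_range P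

/-- Group the `u` by `g = gcd(A, u)`, a divisor of `A`. Within a group `u = g t` with distinct `t`,
and the term is `t ^ (-s)`. -/
theorem sum_gcd_div_rpow_le {s : ℝ} (hs : 1 < s) {A : ℕ} (hA : A ≠ 0) (D : Finset ℕ) :
    ∑ u ∈ D, ((A.gcd u : ℝ) / u) ^ s ≤ A.divisors.card * ∑' t : ℕ, 1 / (t : ℝ) ^ s := by
  have hmaps : ∀ u ∈ D, A.gcd u ∈ A.divisors := fun u _ =>
    Nat.mem_divisors.mpr ⟨Nat.gcd_dvd_left _ _, hA⟩
  rw [← Finset.sum_fiberwise_of_maps_to hmaps, ← nsmul_eq_mul]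
  refine Finset.sum_le_card_nsmul _ _ _ fun g hg => ?_
  have hg0 : 0 < g := Nat.pos_of_mem_divisors hg
  have hdvd : ∀ u ∈ D.filter (fun u => A.gcd u = g), g ∣ u := fun u hu => by
    rw [← (Finset.mem_filter.mp hu).2]; exact Nat.gcd_dvd_right _ _
  have hinj : Set.InjOn (fun u => u / g) (D.filter (fun u => A.gcd u = g) : Finset ℕ) := by
    intro u hu v hv h
    exact (Nat.div_left_inj (hdvd u hu) (hdvd v hv)).mp h
  calc _ = ∑ u ∈ D.filter (fun u => A.gcd u = g), 1 / (((u / g : ℕ) : ℝ)) ^ s := by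
        refine Finset.sum_congr rfl fun u hu => ?_
        rw [Nat.cast_div (hdvd u hu) (by positivity), (Finset.mem_filter.mp hu).2,
          one_div, ← Real.inv_rpow (by positivity), inv_div]
    _ = ∑ t ∈ (D.filter (fun u => A.gcd u = g)).image (fun u => u / g), 1 / (t : ℝ) ^ s := by
        rw [Finset.sum_image hinj]
    _ ≤ _ := (Real.summable_one_div_nat_rpow.mpr hs).sum_le_tsum _ (fun _ _ => by positivity)

/-! ### GCD sums -/

/-- The kernel `(gcd(d,e)² / (d e)) ^ σ` of a GCD sum. -/
noncomputable def gcdWeight (σ : ℝ) (d e : ℕ) : ℝ := ((d.gcd e : ℝ) ^ 2 / (d * e)) ^ σ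

theorem gcdWeight_nonneg (σ : ℝ) (d e : ℕ) : 0 ≤ gcdWeight σ d e := by
  unfold gcdWeight; positivity

theorem gcdWeight_comm (σ : ℝ) (d e : ℕ) : gcdWeight σ d e = gcdWeight σ e d := by
  unfold gcdWeight; rw [Nat.gcd_comm, mul_comm (d : ℝ)]

theorem gcd_sq_div_le_one {d e : ℕ} (hd : 0 < d) (he : 0 < e) :
    (d.gcd e : ℝ) ^ 2 / (d * e) ≤ 1 := by
  rw [div_le_one (by positivity), sq]
  gcongr
  · exact Nat.gcd_le_left _ hd
  · exact Nat.gcd_le_right _ he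

theorem gcdWeight_le_one {σ : ℝ} (hσ : 0 ≤ σ) {d e : ℕ} (hd : 0 < d) (he : 0 < e) :
    gcdWeight σ d e ≤ 1 :=
  Real.rpow_le_one (by positivity) (gcd_sq_div_le_one hd he) hσ

/-- With `d = G A = g u`, `d' = G B`, `e = g v`, where `G = gcd(d, d')` and `g = gcd(d, e)`,
everything reduces to `u gcd(e, d') ≤ G gcd(A, u) gcd(B, v)`. -/
theorem gcd_sq_div_mul_le {d d' e : ℕ} (hd : 0 < d) (hd' : 0 < d') (he : 0 < e) :
    ((d.gcd e : ℝ) ^ 2 / (d * e)) * ((e.gcd d' : ℝ) ^ 2 / (e * d')) ≤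
      ((d.gcd d' : ℝ) ^ 2 / (d * d')) *
        ((((d / d.gcd d').gcd (d / d.gcd e) : ℕ) : ℝ) / (d / d.gcd e : ℕ)) ^ 2 *
        ((((d' / d.gcd d').gcd (e / d.gcd e) : ℕ) : ℝ) / (e / d.gcd e : ℕ)) ^ 2 := by
  have hG : 0 < d.gcd d' := Nat.gcd_pos_of_pos_left _ hd
  have hg : 0 < d.gcd e := Nat.gcd_pos_of_pos_left _ hd
  have hcop : Nat.Coprime (d / d.gcd d') (d' / d.gcd d') := Nat.coprime_div_gcd_div_gcd hG
  have hcop' : Nat.Coprime (d / d.gcd e) (e / d.gcd e) := Nat.coprime_div_gcd_div_gcd hg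
  have e1 : d.gcd d' * (d / d.gcd d') = d := Nat.mul_div_cancel' (Nat.gcd_dvd_left _ _)
  have e2 : d.gcd d' * (d' / d.gcd d') = d' := Nat.mul_div_cancel' (Nat.gcd_dvd_right _ _)
  have e3 : d.gcd e * (d / d.gcd e) = d := Nat.mul_div_cancel' (Nat.gcd_dvd_left _ _)
  have e4 : d.gcd e * (e / d.gcd e) = e := Nat.mul_div_cancel' (Nat.gcd_dvd_right _ _)
  generalize d.gcd d' = G at *
  generalize d.gcd e = g at *
  generalize d / G = A at *
  generalize d' / G = B at *
  generalize d / g = u at *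
  generalize e / g = v at *
  have hA : 0 < A := Nat.pos_of_ne_zero (by rintro rfl; omega)
  have hB : 0 < B := Nat.pos_of_ne_zero (by rintro rfl; omega)
  have hu : 0 < u := Nat.pos_of_ne_zero (by rintro rfl; omega)
  have hv : 0 < v := Nat.pos_of_ne_zero (by rintro rfl; omega)
  have key : u * e.gcd d' ≤ G * (A.gcd u * B.gcd v) := by
    -- Here `u e = d v = G A v` and `u d' = G B u`; the remaining gcd splits because `A`, `B` and
    -- `u`, `v` are coprime pairs.
    have h1 : u * e.gcd d' = G * (A * v).gcd (B * u) := by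
      rw [← Nat.gcd_mul_left, ← Nat.gcd_mul_left]
      congr 1
      · rw [← e4, ← mul_assoc, ← mul_assoc, e1, ← e3]; ring
      · rw [← e2]; ring
    have h2 : (A * v).gcd (B * u) ∣ A.gcd u * B.gcd v := by
      have := Nat.gcd_mul_left_dvd_mul_gcd (B * u) A v
      refine this.trans (mul_dvd_mul ?_ ?_)
      · rw [Nat.Coprime.gcd_mul_left_cancel_right _ hcop.symm]
      · rw [mul_comm B, Nat.Coprime.gcd_mul_left_cancel_right _ hcop', Nat.gcd_comm]
    rw [h1]
    exact Nat.mul_le_mul_left _ (Nat.le_of_dvd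
      (Nat.mul_pos (Nat.gcd_pos_of_pos_left _ hA) (Nat.gcd_pos_of_pos_left _ hB)) h2)
  have keyR : (u : ℝ) * e.gcd d' ≤ G * (A.gcd u * B.gcd v) := by exact_mod_cast key
  generalize e.gcd d' = h at *
  generalize A.gcd u = p at *
  generalize B.gcd v = q at *
  have r3 : (G : ℝ) * A = g * u := by exact_mod_cast e1.trans e3.symm
  subst e4 e2
  have r1 : (d : ℝ) = g * u := by exact_mod_cast e3.symm
  rw [r1]
  push_cast
  have hG' : (0 : ℝ) < G := by exact_mod_cast hG
  have hg' : (0 : ℝ) < g := by exact_mod_cast hg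
  have hu' : (0 : ℝ) < u := by exact_mod_cast hu
  have hv' : (0 : ℝ) < v := by exact_mod_cast hv
  have hB' : (0 : ℝ) < B := by exact_mod_cast hB
  calc _ = ((u : ℝ) * h) ^ 2 / (u ^ 3 * v ^ 2 * g * G * B) := by field_simp
    _ ≤ (G * (p * q) : ℝ) ^ 2 / (u ^ 3 * v ^ 2 * g * G * B) := by gcongr
    _ = _ := by field_simp

/-- The kernel almost reproduces itself under composition. The sum over `e` is dominated by a
product of two divisor-type sums, convergent since `2 σ > 1`. Their size, the divisor counts of `A`
and `B`, is absorbed by lowering `σ` to `σ'`, as the kernel at `(d, d')` is `(A B) ^ (-σ)`. -/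
theorem exists_sum_gcdWeight_mul_le {σ σ' : ℝ} (hσ : 1 / 2 < σ) (h : σ' < σ) :
    ∃ C : ℝ, 0 < C ∧ ∀ D : Finset ℕ, (∀ e ∈ D, 0 < e) → ∀ d d' : ℕ, 0 < d → 0 < d' →
      ∑ e ∈ D, gcdWeight σ d e * gcdWeight σ e d' ≤ C * gcdWeight σ' d d' := by
  obtain ⟨C, hC, hdiv⟩ := exists_card_divisors_le_mul_rpow (sub_pos.mpr h)
  set Z : ℝ := ∑' t : ℕ, 1 / (t : ℝ) ^ (2 * σ) with hZ
  have hs : 1 < 2 * σ := by linarith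
  have hZ0 : 0 < Z := (Real.summable_one_div_nat_rpow.mpr hs).tsum_pos
    (fun _ => by positivity) 1 (by simp)
  refine ⟨(C * Z) ^ 2, by positivity, fun D hD d d' hd hd' => ?_⟩
  have hG : 0 < d.gcd d' := Nat.gcd_pos_of_pos_left _ hd
  set A := d / d.gcd d' with hA
  set B := d' / d.gcd d' with hB
  have e1 : d.gcd d' * A = d := Nat.mul_div_cancel' (Nat.gcd_dvd_left _ _)
  have e2 : d.gcd d' * B = d' := Nat.mul_div_cancel' (Nat.gcd_dvd_right _ _)
  have hA0 : 0 < A := Nat.pos_of_ne_zero (by intro h; rw [h] at e1; omega)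
  have hB0 : 0 < B := Nat.pos_of_ne_zero (by intro h; rw [h] at e2; omega)
  set φ : ℕ → ℝ := fun u => ((A.gcd u : ℝ) / u) ^ (2 * σ)
  set ψ : ℕ → ℝ := fun v => ((B.gcd v : ℝ) / v) ^ (2 * σ)
  have hφ : ∀ u, 0 ≤ φ u := fun u => by positivity
  have hψ : ∀ u, 0 ≤ ψ u := fun u => by positivity
  have hterm : ∀ e ∈ D, gcdWeight σ d e * gcdWeight σ e d' ≤
      gcdWeight σ d d' * (φ (d / d.gcd e) * ψ (e / d.gcd e)) := by
    intro e he
    have h0 := gcd_sq_div_mul_le hd hd' (hD e he)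
    unfold gcdWeight
    rw [← Real.mul_rpow (by positivity) (by positivity)]
    refine (Real.rpow_le_rpow (by positivity) h0 (by linarith)).trans_eq ?_
    rw [Real.mul_rpow (by positivity) (by positivity), Real.mul_rpow (by positivity) (by positivity),
      mul_assoc]
    simp only [φ, ψ, ← hA, ← hB]
    rw [Real.rpow_mul (by positivity), Real.rpow_mul (by positivity), Real.rpow_two, Real.rpow_two]
  -- As `d` is fixed, the first coordinate recovers `gcd(d, e)`, and the second then recovers `e`.
  have hinj : Set.InjOn (fun e => (d / d.gcd e, e / d.gcd e)) (D : Set ℕ) := by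
    intro e he f hf hef
    simp only [Prod.mk.injEq] at hef
    have a1 := Nat.mul_div_cancel' (Nat.gcd_dvd_left d e)
    have a2 := Nat.mul_div_cancel' (Nat.gcd_dvd_right d e)
    have b1 := Nat.mul_div_cancel' (Nat.gcd_dvd_left d f)
    have b2 := Nat.mul_div_cancel' (Nat.gcd_dvd_right d f)
    rw [← hef.1] at b1
    rw [← hef.2] at b2
    have hpos : 0 < d / d.gcd e := Nat.pos_of_ne_zero (by intro h; rw [h] at a1; omega)
    have : d.gcd e = d.gcd f := Nat.eq_of_mul_eq_mul_right hpos (a1.trans b1.symm)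
    rw [← a2, ← b2, this]
  have hsum : ∑ e ∈ D, φ (d / d.gcd e) * ψ (e / d.gcd e) ≤
      (A.divisors.card * Z) * (B.divisors.card * Z) := by
    calc _ = ∑ x ∈ D.image (fun e => (d / d.gcd e, e / d.gcd e)), φ x.1 * ψ x.2 := by
          rw [Finset.sum_image hinj]
      _ ≤ ∑ x ∈ (D.image (fun e => d / d.gcd e)) ×ˢ (D.image (fun e => e / d.gcd e)),
            φ x.1 * ψ x.2 := by
          refine Finset.sum_le_sum_of_subset_of_nonneg ?_
            (fun x _ _ => mul_nonneg (hφ _) (hψ _))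
          intro x hx
          obtain ⟨e, he, rfl⟩ := Finset.mem_image.mp hx
          exact Finset.mk_mem_product (Finset.mem_image_of_mem (fun e => d / d.gcd e) he)
            (Finset.mem_image_of_mem (fun e => e / d.gcd e) he)
      _ = (∑ u ∈ D.image (fun e => d / d.gcd e), φ u) *
            ∑ v ∈ D.image (fun e => e / d.gcd e), ψ v := by
          rw [Finset.sum_product, Finset.sum_mul_sum]
      _ ≤ _ := mul_le_mul (sum_gcd_div_rpow_le hs hA0.ne' _) (sum_gcd_div_rpow_le hs hB0.ne' _)
          (Finset.sum_nonneg fun _ _ => hψ _) (by positivity)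
  have hAB : (d.gcd d' : ℝ) ^ 2 / (d * d') = ((A : ℝ) * B)⁻¹ := by
    have r1 : (d : ℝ) = d.gcd d' * A := by exact_mod_cast e1.symm
    have r2 : (d' : ℝ) = d.gcd d' * B := by exact_mod_cast e2.symm
    have : (0 : ℝ) < d.gcd d' := by exact_mod_cast hG
    have : (0 : ℝ) < A := by exact_mod_cast hA0
    have : (0 : ℝ) < B := by exact_mod_cast hB0
    generalize d.gcd d' = G at *
    rw [r1, r2]
    field_simp
  calc _ ≤ ∑ e ∈ D, gcdWeight σ d d' * (φ (d / d.gcd e) * ψ (e / d.gcd e)) :=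
        Finset.sum_le_sum hterm
    _ ≤ gcdWeight σ d d' * ((A.divisors.card * Z) * (B.divisors.card * Z)) := by
        rw [← Finset.mul_sum]
        exact mul_le_mul_of_nonneg_left hsum (gcdWeight_nonneg _ _ _)
    _ ≤ gcdWeight σ d d' * ((C * (A : ℝ) ^ (σ - σ') * Z) * (C * (B : ℝ) ^ (σ - σ') * Z)) := by
        refine mul_le_mul_of_nonneg_left ?_ (gcdWeight_nonneg _ _ _)
        gcongr
        · exact hdiv A
        · exact hdiv B
    _ = (C * Z) ^ 2 * (gcdWeight σ d d' * ((A : ℝ) * B) ^ (σ - σ')) := by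
        rw [Real.mul_rpow (by positivity) (by positivity)]; ring
    _ = _ := by
        have : (0 : ℝ) < (A : ℝ) * B := by positivity
        unfold gcdWeight
        rw [hAB, Real.inv_rpow this.le, Real.inv_rpow this.le, ← Real.rpow_neg this.le,
          ← Real.rpow_neg this.le, ← Real.rpow_add this]
        congr 2; ring

/-- Cauchy–Schwarz in one variable; expanding the square composes the kernel with itself, where `hC`
applies. -/
theorem sq_sum_gcdWeight_le {σ σ' C : ℝ} {D : Finset ℕ} (hD : ∀ e ∈ D, 0 < e) {r : ℕ → ℝ}
    (hr : ∀ d, 0 ≤ r d)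
    (hC : ∀ d d' : ℕ, 0 < d → 0 < d' →
      ∑ e ∈ D, gcdWeight σ d e * gcdWeight σ e d' ≤ C * gcdWeight σ' d d') :
    (∑ d ∈ D, ∑ e ∈ D, r d * r e * gcdWeight σ d e) ^ 2 ≤
      (∑ d ∈ D, r d ^ 2) * (C * ∑ d ∈ D, ∑ e ∈ D, r d * r e * gcdWeight σ' d e) := by
  have h1 : ∑ d ∈ D, ∑ e ∈ D, r d * r e * gcdWeight σ d e =
      ∑ e ∈ D, r e * ∑ d ∈ D, r d * gcdWeight σ d e := by
    rw [Finset.sum_comm]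
    refine Finset.sum_congr rfl fun e _ => ?_
    rw [Finset.mul_sum]
    exact Finset.sum_congr rfl fun d _ => by ring
  rw [h1]
  refine (Finset.sum_mul_sq_le_sq_mul_sq _ _ _).trans ?_
  refine mul_le_mul_of_nonneg_left ?_ (Finset.sum_nonneg fun _ _ => sq_nonneg _)
  calc ∑ e ∈ D, (∑ d ∈ D, r d * gcdWeight σ d e) ^ 2
      = ∑ d ∈ D, ∑ d' ∈ D, r d * r d' * ∑ e ∈ D, gcdWeight σ d e * gcdWeight σ e d' := by
        simp_rw [sq, Finset.sum_mul_sum, Finset.mul_sum]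
        rw [Finset.sum_comm]
        refine Finset.sum_congr rfl fun d _ => ?_
        rw [Finset.sum_comm]
        refine Finset.sum_congr rfl fun d' _ => Finset.sum_congr rfl fun e _ => ?_
        rw [gcdWeight_comm σ d' e]; ring
    _ ≤ ∑ d ∈ D, ∑ d' ∈ D, r d * r d' * (C * gcdWeight σ' d d') :=
        Finset.sum_le_sum fun d hd => Finset.sum_le_sum fun d' hd' =>
          mul_le_mul_of_nonneg_left (hC d d' (hD d hd) (hD d' hd')) (mul_nonneg (hr d) (hr d'))
    _ = _ := by
        simp_rw [Finset.mul_sum]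
        exact Finset.sum_congr rfl fun d _ => Finset.sum_congr rfl fun e _ => by ring

/-- The trivial bound has exponent `1`. Each Cauchy–Schwarz step takes a square root and so halves
the exponent, at the price of a smaller `σ'`, which still fits above `1 / 2`. -/
theorem exists_sum_gcdWeight_le_half_pow (j : ℕ) : ∀ σ : ℝ, 1 / 2 < σ →
    ∃ C : ℝ, 0 < C ∧ ∀ D : Finset ℕ, (∀ e ∈ D, 0 < e) → ∀ r : ℕ → ℝ, (∀ d, 0 ≤ r d) →
      ∑ d ∈ D, ∑ e ∈ D, r d * r e * gcdWeight σ d e ≤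
        C * (D.card : ℝ) ^ ((1 / 2 : ℝ) ^ j) * ∑ d ∈ D, r d ^ 2 := by
  induction j with
  | zero =>
    intro σ hσ
    refine ⟨1, one_pos, fun D hD r hr => ?_⟩
    calc _ ≤ ∑ d ∈ D, ∑ e ∈ D, r d * r e :=
          Finset.sum_le_sum fun d hd => Finset.sum_le_sum fun e he =>
            mul_le_of_le_one_right (mul_nonneg (hr d) (hr e))
              (gcdWeight_le_one (by linarith) (hD d hd) (hD e he))
      _ = (∑ d ∈ D, r d) ^ 2 := by rw [sq, Finset.sum_mul_sum]
      _ ≤ D.card * ∑ d ∈ D, r d ^ 2 := sq_sum_le_card_mul_sum_sq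
      _ = _ := by simp
  | succ j ih =>
    intro σ hσ
    obtain ⟨σ', h1, h2⟩ := exists_between hσ
    obtain ⟨C₁, hC₁, H₁⟩ := exists_sum_gcdWeight_mul_le hσ h2
    obtain ⟨C₂, hC₂, H₂⟩ := ih σ' h1
    refine ⟨√(C₁ * C₂), by positivity, fun D hD r hr => ?_⟩
    have hQ : 0 ≤ ∑ d ∈ D, r d ^ 2 := Finset.sum_nonneg fun _ _ => sq_nonneg _
    refine le_of_sq_le_sq ?_ (by positivity)
    calc _ ≤ (∑ d ∈ D, r d ^ 2) * (C₁ * ∑ d ∈ D, ∑ e ∈ D, r d * r e * gcdWeight σ' d e) :=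
          sq_sum_gcdWeight_le hD hr (H₁ D hD)
      _ ≤ (∑ d ∈ D, r d ^ 2) *
            (C₁ * (C₂ * (D.card : ℝ) ^ ((1 / 2 : ℝ) ^ j) * ∑ d ∈ D, r d ^ 2)) := by
          gcongr
          exact H₂ D hD r hr
      _ = _ := by
          rw [mul_pow, mul_pow, Real.sq_sqrt (by positivity), ← Real.rpow_natCast (_ ^ _) 2,
            ← Real.rpow_mul (by positivity)]
          have : (1 / 2 : ℝ) ^ (j + 1) * (2 : ℕ) = (1 / 2) ^ j := by push_cast; ring
          rw [this]; ring

/-- The left side is at most `x ^ (1 / 2)`, `x = gcd² / (d e)`, the critical exponent. Either this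
is below `K⁻¹`, or passing to exponent `σ` loses at most `K ^ (2 σ - 1)`. -/
theorem gcd_div_max_le {d e : ℕ} (hd : 0 < d) (he : 0 < e) {σ K : ℝ} (hσ : 1 / 2 ≤ σ)
    (hK : 0 < K) :
    (d.gcd e : ℝ) / max (d : ℝ) e ≤ K ^ (2 * σ - 1) * gcdWeight σ d e + K⁻¹ := by
  have hg : (0 : ℝ) < d.gcd e := by exact_mod_cast Nat.gcd_pos_of_pos_left _ hd
  have hd' : (0 : ℝ) < d := by exact_mod_cast hd
  have he' : (0 : ℝ) < e := by exact_mod_cast he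
  unfold gcdWeight
  set x : ℝ := (d.gcd e : ℝ) ^ 2 / (d * e) with hx
  have hx0 : 0 < x := by positivity
  have hm : 0 < max (d : ℝ) e := lt_max_of_lt_left hd'
  have h1 : (d.gcd e : ℝ) / max (d : ℝ) e ≤ x ^ (1 / 2 : ℝ) := by
    rw [← Real.sqrt_eq_rpow]
    refine Real.le_sqrt_of_sq_le ?_
    rw [div_pow, hx]
    refine div_le_div_of_nonneg_left (by positivity) (by positivity) ?_
    rw [sq]
    exact mul_le_mul (le_max_left _ _) (le_max_right _ _) he'.le hm.le
  refine h1.trans ?_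
  have hw : 0 < x ^ σ := by positivity
  rcases le_total (x * K ^ 2) 1 with h | h
  · have : x ^ (1 / 2 : ℝ) ≤ K⁻¹ := by
      rw [← Real.sqrt_eq_rpow]
      refine Real.sqrt_le_iff.mpr ⟨by positivity, ?_⟩
      rw [inv_pow, ← one_div, le_div_iff₀ (by positivity)]
      exact h
    have h0 : 0 ≤ K ^ (2 * σ - 1) * x ^ σ := by positivity
    linarith
  · have h2 : 1 ≤ (x * K ^ 2) ^ (σ - 1 / 2) := Real.one_le_rpow h (by linarith)
    have h3 : (x * K ^ 2) ^ (σ - 1 / 2) = x ^ (σ - 1 / 2) * K ^ (2 * σ - 1) := by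
      rw [Real.mul_rpow hx0.le (by positivity), ← Real.rpow_two, ← Real.rpow_mul hK.le]
      congr 2; ring
    have h4 : x ^ σ = x ^ (1 / 2 : ℝ) * x ^ (σ - 1 / 2) := by
      rw [← Real.rpow_add hx0]; congr 1; ring
    have h5 : x ^ (1 / 2 : ℝ) ≤ K ^ (2 * σ - 1) * x ^ σ := by
      calc x ^ (1 / 2 : ℝ) ≤ x ^ (1 / 2 : ℝ) * (x ^ (σ - 1 / 2) * K ^ (2 * σ - 1)) :=
            le_mul_of_one_le_right (by positivity) (h3 ▸ h2)
        _ = _ := by rw [h4]; ring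
    have : 0 ≤ K⁻¹ := by positivity
    linarith

theorem exists_sum_gcd_div_max_le {ε : ℝ} (hε : 0 < ε) :
    ∃ C : ℝ, 0 < C ∧ ∀ D : Finset ℕ, (∀ e ∈ D, 0 < e) → ∀ r : ℕ → ℝ, (∀ d, 0 ≤ r d) →
      ∑ d ∈ D, ∑ e ∈ D, r d * r e * ((d.gcd e : ℝ) / max (d : ℝ) e) ≤
        C * (D.card : ℝ) ^ ε * ∑ d ∈ D, r d ^ 2 := by
  -- The budget `ε` is split evenly: `ε / 2` for the iterated bound and `2 σ - 1 = ε / 2` for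
  -- leaving the critical exponent, with cutoff `K = |D|`.
  obtain ⟨j, hj⟩ := exists_pow_lt_of_lt_one (half_pos hε) (by norm_num : (1 / 2 : ℝ) < 1)
  obtain ⟨C, hC, H⟩ := exists_sum_gcdWeight_le_half_pow j (1 / 2 + ε / 4) (by linarith)
  refine ⟨C + 1, by positivity, fun D hD r hr => ?_⟩
  rcases D.eq_empty_or_nonempty with rfl | hne
  · simp
  have hK : (1 : ℝ) ≤ D.card := by exact_mod_cast hne.card_pos
  set K : ℝ := (D.card : ℝ) with hKdef
  have hK0 : 0 < K := by linarith
  set Q := ∑ d ∈ D, r d ^ 2 with hQdef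
  have hQ : 0 ≤ Q := Finset.sum_nonneg fun _ _ => sq_nonneg _
  have hexp : 2 * (1 / 2 + ε / 4) - 1 = ε / 2 := by ring
  have hS2 : ∑ d ∈ D, ∑ e ∈ D, r d * r e ≤ K * Q := by
    rw [← Finset.sum_mul_sum, ← sq]; exact sq_sum_le_card_mul_sum_sq
  calc _ ≤ ∑ d ∈ D, ∑ e ∈ D, r d * r e *
            (K ^ (ε / 2) * gcdWeight (1 / 2 + ε / 4) d e + K⁻¹) :=
        Finset.sum_le_sum fun d hd => Finset.sum_le_sum fun e he =>
          mul_le_mul_of_nonneg_left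
            (hexp ▸ gcd_div_max_le (hD d hd) (hD e he) (by linarith) hK0)
            (mul_nonneg (hr d) (hr e))
    _ = K ^ (ε / 2) * (∑ d ∈ D, ∑ e ∈ D, r d * r e * gcdWeight (1 / 2 + ε / 4) d e) +
          K⁻¹ * ∑ d ∈ D, ∑ e ∈ D, r d * r e := by
        simp_rw [Finset.mul_sum, ← Finset.sum_add_distrib]
        exact Finset.sum_congr rfl fun d _ => Finset.sum_congr rfl fun e _ => by ring
    _ ≤ K ^ (ε / 2) * (C * K ^ ((1 / 2 : ℝ) ^ j) * Q) + K⁻¹ * (K * Q) := by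
        gcongr
        exact H D hD r hr
    _ ≤ K ^ (ε / 2) * (C * K ^ (ε / 2) * Q) + K⁻¹ * (K * Q) := by
        gcongr
    _ = C * K ^ ε * Q + Q := by
        have : K ^ ε = K ^ (ε / 2) * K ^ (ε / 2) := by
          rw [← Real.rpow_add hK0]; congr 1; ring
        rw [this, inv_mul_cancel_left₀ hK0.ne']; ring
    _ ≤ _ := by
        have : Q ≤ K ^ ε * Q := le_mul_of_one_le_left hQ (Real.one_le_rpow hK hε.le)
        linarith

/-! ### Dilated indicators: means, correlations and variance -/

theorem distNearestInt_le_abs_sub (x : ℝ) (k : ℤ) : distNearestInt x ≤ |x - k| :=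
  round_le x k

theorem distNearestInt_neg (x : ℝ) : distNearestInt (-x) = distNearestInt x := by
  have h : ∀ y, distNearestInt (-y) ≤ distNearestInt y := fun y => by
    refine (distNearestInt_le_abs_sub _ (-round y)).trans_eq ?_
    rw [distNearestInt, ← abs_neg]
    congr 1; push_cast; ring
  exact le_antisymm (h x) (by simpa using h (-x))

theorem distNearestInt_add_intCast (x : ℝ) (k : ℤ) : distNearestInt (x + k) = distNearestInt x := by
  simp [distNearestInt, round_add_intCast]

theorem distNearestInt_eq_abs {x : ℝ} (hx : |x| ≤ 1 / 2) : distNearestInt x = |x| := by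
  refine le_antisymm (by simpa using distNearestInt_le_abs_sub x 0) ?_
  rw [distNearestInt]
  rcases eq_or_ne (round x) 0 with h | h
  · simp [h]
  · have h1 : (1 : ℝ) ≤ |(round x : ℝ)| := by exact_mod_cast Int.one_le_abs h
    have h2 := abs_sub_abs_le_abs_sub (round x : ℝ) x
    rw [abs_sub_comm] at h2
    linarith

theorem measurable_distNearestInt : Measurable distNearestInt := by
  unfold distNearestInt
  simp_rw [round_eq]
  fun_prop

/-- The indicator function of the real numbers within `δ` of an integer. -/
noncomputable def nearIntIndicator (δ : ℝ) : ℝ → ℝ := {y | distNearestInt y ≤ δ}.indicator 1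

theorem nearIntIndicator_apply (δ y : ℝ) [Decidable (distNearestInt y ≤ δ)] :
    nearIntIndicator δ y = if distNearestInt y ≤ δ then 1 else 0 := by
  simp [nearIntIndicator, Set.indicator_apply]

theorem nearIntIndicator_nonneg (δ y : ℝ) : 0 ≤ nearIntIndicator δ y :=
  Set.indicator_nonneg (fun _ _ => zero_le_one) _

theorem nearIntIndicator_le_one (δ y : ℝ) : nearIntIndicator δ y ≤ 1 :=
  Set.indicator_le_self' (fun _ _ => zero_le_one) _

theorem measurable_nearIntIndicator (δ : ℝ) : Measurable (nearIntIndicator δ) :=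
  measurable_one.indicator (measurableSet_le measurable_distNearestInt measurable_const)

theorem nearIntIndicator_add_intCast (δ y : ℝ) (k : ℤ) :
    nearIntIndicator δ (y + k) = nearIntIndicator δ y := by
  classical simp [nearIntIndicator_apply, distNearestInt_add_intCast]

theorem nearIntIndicator_add_natCast (δ y : ℝ) (k : ℕ) :
    nearIntIndicator δ (y + k) = nearIntIndicator δ y :=
  nearIntIndicator_add_intCast δ y k

theorem intervalIntegrable_of_mem_Icc {F : ℝ → ℝ} (hF : Measurable F) (h0 : ∀ x, 0 ≤ F x)
    (h1 : ∀ x, F x ≤ 1) (a b : ℝ) : IntervalIntegrable F volume a b :=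
  (intervalIntegrable_const (c := (1 : ℝ))).mono_fun hF.aestronglyMeasurable
    (Eventually.of_forall fun x => by simpa [abs_of_nonneg (h0 x)] using h1 x)

theorem intervalIntegrable_sum {ι : Type*} (s : Finset ι) {f : ι → ℝ → ℝ} {a b : ℝ}
    (h : ∀ i ∈ s, IntervalIntegrable (f i) volume a b) :
    IntervalIntegrable (fun x => ∑ i ∈ s, f i x) volume a b := by
  simpa only [Finset.sum_fn] using IntervalIntegrable.sum s h

theorem integral_nearIntIndicator {δ : ℝ} (h0 : 0 ≤ δ) (h1 : δ ≤ 1 / 2) :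
    ∫ y in (0 : ℝ)..1, nearIntIndicator δ y = 2 * δ := by
  have hper : Function.Periodic (nearIntIndicator δ) 1 := fun y => by
    simpa using nearIntIndicator_add_natCast δ y 1
  have h := hper.intervalIntegral_add_eq 0 (-(1 / 2))
  rw [zero_add] at h
  rw [h, show -(1 / 2) + 1 = (1 / 2 : ℝ) by norm_num,
    intervalIntegral.integral_of_le (by norm_num), ← integral_Icc_eq_integral_Ioc]
  have : ∀ y ∈ Set.Icc (-(1 / 2) : ℝ) (1 / 2),
      nearIntIndicator δ y = (Set.Icc (-δ) δ).indicator 1 y := by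
    intro y hy
    classical
    rw [nearIntIndicator_apply, distNearestInt_eq_abs (abs_le.mpr hy), Set.indicator_apply]
    simp [abs_le]
  rw [setIntegral_congr_fun measurableSet_Icc this, setIntegral_indicator measurableSet_Icc,
    Set.inter_eq_right.mpr (Set.Icc_subset_Icc (by linarith) h1)]
  simp only [Pi.one_apply, integral_const, MeasurableSet.univ, measureReal_restrict_apply,
    Set.univ_inter, Real.volume_real_Icc, smul_eq_mul, mul_one]
  rw [max_eq_left (by linarith)]
  ring

theorem integral_comp_natCast_mul {F : ℝ → ℝ} (hF : ∀ a b, IntervalIntegrable F volume a b)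
    {n : ℕ} (hn : 0 < n) :
    ∫ x in (0 : ℝ)..1, F (n * x) =
      (n : ℝ)⁻¹ * ∫ y in (0 : ℝ)..1, ∑ k ∈ Finset.range n, F (y + k) := by
  have hn' : (n : ℝ) ≠ 0 := by positivity
  rw [intervalIntegral.integral_comp_mul_left F hn', smul_eq_mul, mul_zero, mul_one]
  congr 1
  rw [intervalIntegral.integral_finsetSum]
  · have := intervalIntegral.sum_integral_adjacent_intervals (f := F) (μ := volume)
      (a := fun k : ℕ => (k : ℝ)) (n := n) (fun k _ => hF _ _)
    simp only [Nat.cast_zero] at this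
    rw [← this]
    refine Finset.sum_congr rfl fun k _ => ?_
    rw [intervalIntegral.integral_comp_add_right F (k : ℝ)]
    push_cast
    rw [zero_add, add_comm]
  · intro k _
    simpa using (hF (0 + k) (1 + k)).comp_add_right (k : ℝ)

theorem integral_nearIntIndicator_natCast_mul {δ : ℝ} (h0 : 0 ≤ δ) (h1 : δ ≤ 1 / 2) {n : ℕ}
    (hn : 0 < n) : ∫ x in (0 : ℝ)..1, nearIntIndicator δ (n * x) = 2 * δ := by
  rw [integral_comp_natCast_mul (intervalIntegrable_of_mem_Icc (measurable_nearIntIndicator δ)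
    (nearIntIndicator_nonneg δ) (nearIntIndicator_le_one δ)) hn]
  simp_rw [nearIntIndicator_add_natCast, Finset.sum_const, Finset.card_range, nsmul_eq_mul]
  rw [intervalIntegral.integral_const_mul, integral_nearIntIndicator h0 h1]
  have : (n : ℝ) ≠ 0 := by positivity
  field_simp

/-- Modulo one, the points run `g = gcd(d, n)` times through a translate of the multiples of `1 /
v`, `v = n / g`, and an interval of length `2 δ` holds at most `2 δ v + 1` of those. -/
theorem sum_nearIntIndicator_le {δ : ℝ} (h0 : 0 ≤ δ) (θ : ℝ) (d : ℕ) {n : ℕ} (hn : 0 < n) :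
    ∑ k ∈ Finset.range n, nearIntIndicator δ (θ + d * k / n) ≤ 2 * δ * n + d.gcd n := by
  classical
  have hg : 0 < d.gcd n := Nat.gcd_pos_of_pos_right _ hn
  have hcop : Nat.Coprime (d / d.gcd n) (n / d.gcd n) := Nat.coprime_div_gcd_div_gcd hg
  have e1 : d.gcd n * (d / d.gcd n) = d := Nat.mul_div_cancel' (Nat.gcd_dvd_left _ _)
  have e2 : d.gcd n * (n / d.gcd n) = n := Nat.mul_div_cancel' (Nat.gcd_dvd_right _ _)
  generalize d.gcd n = g at *
  generalize d / g = u at *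
  generalize n / g = v at *
  subst e1 e2
  have hv : 0 < v := Nat.pos_of_mul_pos_left hn
  have hgR : (0 : ℝ) < g := by exact_mod_cast hg
  have hvR : (0 : ℝ) < v := by exact_mod_cast hv
  have harg : ∀ k : ℕ, θ + ((g * u : ℕ) : ℝ) * k / ((g * v : ℕ) : ℝ) = θ + u * k / v := fun k => by
    push_cast; field_simp
  simp_rw [harg, nearIntIndicator_apply]
  rw [Finset.sum_boole]
  set S := (Finset.range (g * v)).filter fun k : ℕ => distNearestInt (θ + u * k / v) ≤ δ
  -- The representative of `u k` modulo `v` for which `θ + j / v` lies in `[-δ, δ]` when `k ∈ S`. It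
  -- determines `k` modulo `v`, and `k / v` does the rest.
  set j : ℕ → ℤ := fun k => u * k - v * round (θ + u * k / v) with hj
  set I : Finset ℤ := Finset.Icc ⌈v * (-δ - θ)⌉ ⌊v * (δ - θ)⌋ with hI
  have hcard : S.card ≤ (I ×ˢ Finset.range g).card := by
    refine Finset.card_le_card_of_injOn (fun k => (j k, k / v)) ?_ ?_
    · intro k hk
      obtain ⟨hk1, hk2⟩ := Finset.mem_filter.mp hk
      have hk1 := Finset.mem_range.mp hk1
      refine Finset.mk_mem_product ?_ (Finset.mem_range.mpr (Nat.div_lt_of_lt_mul (by linarith)))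
      rw [distNearestInt, abs_le] at hk2
      have hjk : (j k : ℝ) = v * (θ + u * k / v - round (θ + u * k / v)) - v * θ := by
        simp only [hj]; push_cast; field_simp; ring
      rw [hI, Finset.mem_Icc, Int.ceil_le, Int.le_floor, hjk]
      constructor <;> nlinarith [hk2.1, hk2.2]
    · intro k _ l _ hkl
      simp only [Prod.mk.injEq, hj] at hkl
      obtain ⟨h1, h2⟩ := hkl
      have hmod : (u * k : ℤ) ≡ u * l [ZMOD v] := by
        rw [Int.modEq_iff_dvd]
        exact ⟨round (θ + u * l / v) - round (θ + u * k / v), by linear_combination -h1⟩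
      have hmod' : u * k ≡ u * l [MOD v] := by
        rw [← Int.natCast_modEq_iff]; exact_mod_cast hmod
      have h3 : k % v = l % v := Nat.ModEq.cancel_left_of_coprime hcop.symm hmod'
      rw [← Nat.div_add_mod k v, ← Nat.div_add_mod l v, h2, h3]
  have hIcard : (I.card : ℝ) ≤ 2 * δ * v + 1 := by
    rw [hI, Int.card_Icc]
    have hx : ((⌊v * (δ - θ)⌋ + 1 - ⌈v * (-δ - θ)⌉ : ℤ) : ℝ) ≤ 2 * δ * v + 1 := by
      push_cast
      have := Int.floor_le (v * (δ - θ))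
      have := Int.le_ceil (v * (-δ - θ))
      linarith
    have h2 : (0 : ℝ) ≤ 2 * δ * v + 1 := by positivity
    rcases le_total 0 (⌊v * (δ - θ)⌋ + 1 - ⌈v * (-δ - θ)⌉) with h | h
    · rw [← Int.toNat_of_nonneg h] at hx
      exact_mod_cast hx
    · rw [Int.toNat_of_nonpos h]; simpa using h2
  calc (S.card : ℝ) ≤ I.card * g := by
        have := hcard; rw [Finset.card_product, Finset.card_range] at this; exact_mod_cast this
    _ ≤ (2 * δ * v + 1) * g := by gcongr
    _ = _ := by push_cast; ring

/-- Substitute `y = n x` and fold `[0, n]` onto `[0, 1]`: the second factor is periodic and factors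
out, while the first is summed over the shifts `d k / n`. -/
theorem integral_nearIntIndicator_mul_le {δ : ℝ} (h0 : 0 ≤ δ) (h1 : δ ≤ 1 / 2) (d : ℕ) {n : ℕ}
    (hn : 0 < n) :
    ∫ x in (0 : ℝ)..1, nearIntIndicator δ (d * x) * nearIntIndicator δ (n * x) ≤
      (2 * δ) ^ 2 + 2 * δ * (d.gcd n / n) := by
  have hnR : (0 : ℝ) < n := by exact_mod_cast hn
  have hm := measurable_nearIntIndicator δ
  have hF : ∀ a b, IntervalIntegrable
      (fun y => nearIntIndicator δ (d * y / n) * nearIntIndicator δ y) volume a b :=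
    intervalIntegrable_of_mem_Icc (by fun_prop)
      (fun x => mul_nonneg (nearIntIndicator_nonneg _ _) (nearIntIndicator_nonneg _ _))
      (fun x => mul_le_one₀ (nearIntIndicator_le_one _ _) (nearIntIndicator_nonneg _ _)
        (nearIntIndicator_le_one _ _))
  have hint := intervalIntegrable_of_mem_Icc hm (nearIntIndicator_nonneg δ)
    (nearIntIndicator_le_one δ) 0 1
  have h := integral_comp_natCast_mul hF hn
  have hL : ∀ x : ℝ, (d : ℝ) * (n * x) / n = d * x := fun x => by field_simp
  simp_rw [hL] at h
  rw [h]
  have hle : ∫ y in (0 : ℝ)..1, ∑ k ∈ Finset.range n,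
      nearIntIndicator δ (d * (y + k) / n) * nearIntIndicator δ (y + k) ≤
      ∫ y in (0 : ℝ)..1, (2 * δ * n + d.gcd n) * nearIntIndicator δ y := by
    refine intervalIntegral.integral_mono_on zero_le_one ?_ (hint.const_mul _) fun y _ => ?_
    · refine intervalIntegrable_sum _ fun k _ => ?_
      simpa using (hF (0 + k) (1 + k)).comp_add_right (k : ℝ)
    · simp_rw [nearIntIndicator_add_natCast, ← Finset.sum_mul, mul_add, add_div]
      exact mul_le_mul_of_nonneg_right (sum_nearIntIndicator_le h0 _ d hn)
        (nearIntIndicator_nonneg _ _)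
  rw [intervalIntegral.integral_const_mul, integral_nearIntIndicator h0 h1] at hle
  calc _ ≤ (n : ℝ)⁻¹ * ((2 * δ * n + d.gcd n) * (2 * δ)) := by gcongr
    _ = _ := by field_simp

theorem integral_nearIntIndicator_mul_le_max {δ : ℝ} (h0 : 0 ≤ δ) (h1 : δ ≤ 1 / 2) {d e : ℕ}
    (hd : 0 < d) (he : 0 < e) :
    ∫ x in (0 : ℝ)..1, nearIntIndicator δ (d * x) * nearIntIndicator δ (e * x) ≤
      (2 * δ) ^ 2 + 2 * δ * (d.gcd e / max (d : ℝ) e) := by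
  rcases le_total d e with h | h
  · rw [max_eq_right (by exact_mod_cast h)]
    exact integral_nearIntIndicator_mul_le h0 h1 d he
  · rw [max_eq_left (by exact_mod_cast h), Nat.gcd_comm]
    simp_rw [mul_comm (nearIntIndicator δ (d * _))]
    exact integral_nearIntIndicator_mul_le h0 h1 e hd

theorem integral_sq_sum_nearIntIndicator_sub_le {ι : Type*} {δ : ℝ} (h0 : 0 ≤ δ) (h1 : δ ≤ 1 / 2)
    (P : Finset ι) (d : ι → ℕ) (hd : ∀ p ∈ P, 0 < d p) :
    ∫ x in (0 : ℝ)..1, (∑ p ∈ P, nearIntIndicator δ (d p * x) - 2 * δ * P.card) ^ 2 ≤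
      2 * δ * ∑ p ∈ P, ∑ q ∈ P, ((d p).gcd (d q) : ℝ) / max (d p : ℝ) (d q) := by
  have hm := measurable_nearIntIndicator δ
  have i1 : ∀ p, IntervalIntegrable (fun x => nearIntIndicator δ (d p * x)) volume 0 1 := fun p =>
    intervalIntegrable_of_mem_Icc (by fun_prop) (fun x => nearIntIndicator_nonneg _ _)
      (fun x => nearIntIndicator_le_one _ _) 0 1
  have i2 : ∀ p q, IntervalIntegrable
      (fun x => nearIntIndicator δ (d p * x) * nearIntIndicator δ (d q * x)) volume 0 1 :=
    fun p q => intervalIntegrable_of_mem_Icc (by fun_prop)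
      (fun x => mul_nonneg (nearIntIndicator_nonneg _ _) (nearIntIndicator_nonneg _ _))
      (fun x => mul_le_one₀ (nearIntIndicator_le_one _ _) (nearIntIndicator_nonneg _ _)
        (nearIntIndicator_le_one _ _)) 0 1
  set M : ℝ := 2 * δ * P.card with hM
  have hexp : ∀ x : ℝ, (∑ p ∈ P, nearIntIndicator δ (d p * x) - M) ^ 2 =
      ∑ p ∈ P, ∑ q ∈ P, nearIntIndicator δ (d p * x) * nearIntIndicator δ (d q * x) -
        2 * M * ∑ p ∈ P, nearIntIndicator δ (d p * x) + M ^ 2 := fun x => by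
    rw [← Finset.sum_mul_sum]; ring
  simp_rw [hexp]
  have j1 : IntervalIntegrable (fun x => ∑ p ∈ P, nearIntIndicator δ (d p * x)) volume 0 1 :=
    intervalIntegrable_sum _ fun p _ => i1 p
  have j2 : IntervalIntegrable (fun x => ∑ p ∈ P, ∑ q ∈ P,
      nearIntIndicator δ (d p * x) * nearIntIndicator δ (d q * x)) volume 0 1 :=
    intervalIntegrable_sum _ fun p _ => intervalIntegrable_sum _ fun q _ => i2 p q
  rw [intervalIntegral.integral_add (j2.sub (j1.const_mul _)) intervalIntegrable_const,
    intervalIntegral.integral_sub j2 (j1.const_mul _), intervalIntegral.integral_const_mul,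
    intervalIntegral.integral_finsetSum (fun p _ => i1 p),
    intervalIntegral.integral_finsetSum
      (fun p _ => intervalIntegrable_sum _ fun q _ => i2 p q),
    Finset.sum_congr rfl fun p hp => integral_nearIntIndicator_natCast_mul h0 h1 (hd p hp)]
  simp_rw [intervalIntegral.integral_finsetSum (fun q _ => i2 _ q)]
  have hle : ∑ p ∈ P, ∑ q ∈ P,
      ∫ x in (0 : ℝ)..1, nearIntIndicator δ (d p * x) * nearIntIndicator δ (d q * x) ≤
      ∑ p ∈ P, ∑ q ∈ P,
        ((2 * δ) ^ 2 + 2 * δ * ((d p).gcd (d q) / max (d p : ℝ) (d q))) :=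
    Finset.sum_le_sum fun p hp => Finset.sum_le_sum fun q hq =>
      integral_nearIntIndicator_mul_le_max h0 h1 (hd p hp) (hd q hq)
  simp only [Finset.sum_add_distrib, Finset.sum_const, nsmul_eq_mul, ← Finset.mul_sum] at hle ⊢
  simp only [intervalIntegral.integral_const, smul_eq_mul]
  rw [hM]
  nlinarith [hle]

/-! ### Multiplicities of differences and the variance of the pair count -/

theorem sum_sum_comp_gcd_div_max {ι : Type*} (P : Finset ι) (d : ι → ℕ) :
    ∑ p ∈ P, ∑ q ∈ P, ((d p).gcd (d q) : ℝ) / max (d p : ℝ) (d q) =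
      ∑ m ∈ P.image d, ∑ n ∈ P.image d,
        ((P.filter fun p => d p = m).card : ℝ) * (P.filter fun p => d p = n).card *
          ((m.gcd n : ℝ) / max (m : ℝ) n) := by
  rw [Finset.sum_comp (fun m : ℕ => ∑ q ∈ P, (m.gcd (d q) : ℝ) / max (m : ℝ) (d q)) d]
  refine Finset.sum_congr rfl fun m _ => ?_
  rw [Finset.sum_comp (fun n : ℕ => (m.gcd n : ℝ) / max (m : ℝ) n) d, nsmul_eq_mul, Finset.mul_sum]
  exact Finset.sum_congr rfl fun n _ => by rw [nsmul_eq_mul, mul_assoc]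

/-- The multiplicities of the values of `d` serve as weights `r`: they sum to `|P|` and are at most
`M`, so their squares sum to at most `M |P|`. -/
theorem exists_sum_sum_gcd_div_max_le {ε : ℝ} (hε : 0 < ε) :
    ∃ C : ℝ, 0 < C ∧ ∀ (P : Finset (ℕ × ℕ)) (d : ℕ × ℕ → ℕ) (M : ℕ), (∀ p ∈ P, 0 < d p) →
      (∀ m, (P.filter fun p => d p = m).card ≤ M) →
      ∑ p ∈ P, ∑ q ∈ P, ((d p).gcd (d q) : ℝ) / max (d p : ℝ) (d q) ≤
        C * (P.card : ℝ) ^ ε * (M * P.card) := by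
  obtain ⟨C, hC, H⟩ := exists_sum_gcd_div_max_le hε
  refine ⟨C, hC, fun P d M hd hM => ?_⟩
  have hpos : ∀ e ∈ P.image d, 0 < e := fun e he => by
    obtain ⟨p, hp, rfl⟩ := Finset.mem_image.mp he
    exact hd p hp
  have hsum : ∑ m ∈ P.image d, ((P.filter fun p => d p = m).card : ℝ) = P.card := by
    exact_mod_cast (Finset.card_eq_sum_card_image d P).symm
  have hsq : ∑ m ∈ P.image d, ((P.filter fun p => d p = m).card : ℝ) ^ 2 ≤ M * P.card := by
    calc _ ≤ ∑ m ∈ P.image d, (M : ℝ) * (P.filter fun p => d p = m).card :=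
          Finset.sum_le_sum fun m _ => by
            rw [sq]
            exact mul_le_mul_of_nonneg_right (by exact_mod_cast hM m) (Nat.cast_nonneg _)
      _ = _ := by rw [← Finset.mul_sum, hsum]
  rw [sum_sum_comp_gcd_div_max]
  refine (H _ hpos _ fun _ => Nat.cast_nonneg _).trans ?_
  gcongr
  exact Finset.card_image_le

/-- The second index and the sign of the difference determine the first index. -/
theorem card_filter_natAbs_sub_eq_le {a : ℕ → ℕ} {s : Finset ℕ} (ha : Set.InjOn a s) (d : ℕ) :
    (s.offDiag.filter fun p => ((a p.1 : ℤ) - a p.2).natAbs = d).card ≤ 2 * s.card := by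
  classical
  have h : (s ×ˢ (Finset.univ : Finset Bool)).card = 2 * s.card := by
    rw [Finset.card_product, Finset.card_univ, Fintype.card_bool, mul_comm]
  rw [← h]
  refine Finset.card_le_card_of_injOn (fun p => (p.2, decide (a p.1 ≤ a p.2))) ?_ ?_
  · intro p hp
    have := (Finset.mem_offDiag.mp (Finset.mem_filter.mp hp).1).2.1
    exact Finset.mk_mem_product this (Finset.mem_univ _)
  · rintro ⟨m, n⟩ hp ⟨m', n'⟩ hq hpq
    simp only [Finset.coe_filter, Finset.mem_offDiag, Set.mem_ofPred_eq] at hp hq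
    simp only [Prod.mk.injEq, decide_eq_decide] at hpq
    obtain ⟨rfl, h2⟩ := hpq
    have : a m = a m' := by
      have h3 := hp.2
      have h4 := hq.2
      by_cases h5 : a m ≤ a n
      · have := h2.mp h5; omega
      · have := mt h2.mpr h5; omega
    rw [ha hp.1.1 hq.1.1 this]

/-- The number of ordered pairs of distinct indices in `{1, …, N}` for which `y m - y n` is within
`δ` of an integer. -/
noncomputable def closePairCount (y : ℕ → ℝ) (δ : ℝ) (N : ℕ) : ℝ :=
  (((Finset.Icc 1 N ×ˢ Finset.Icc 1 N).filter fun p : ℕ × ℕ =>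
      p.1 ≠ p.2 ∧ distNearestInt (y p.1 - y p.2) ≤ δ).card : ℝ)

theorem pairCorrelation_eq (y : ℕ → ℝ) (β s : ℝ) (N : ℕ) :
    pairCorrelation y β s N = closePairCount y (s / (N : ℝ) ^ β) N / (N : ℝ) ^ (2 - β) := by
  rw [pairCorrelation, closePairCount, one_div, inv_mul_eq_div]

theorem closePairCount_nonneg (y : ℕ → ℝ) (δ : ℝ) (N : ℕ) : 0 ≤ closePairCount y δ N :=
  Nat.cast_nonneg _

theorem closePairCount_mono (y : ℕ → ℝ) {δ δ' : ℝ} {N N' : ℕ} (hδ : δ ≤ δ') (hN : N ≤ N') :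
    closePairCount y δ N ≤ closePairCount y δ' N' := by
  unfold closePairCount
  gcongr
  intro p hp
  simp only [Finset.mem_filter, Finset.mem_product, Finset.mem_Icc] at hp ⊢
  exact ⟨by omega, hp.2.1, hp.2.2.trans hδ⟩

theorem closePairCount_natCast_mul (a : ℕ → ℕ) (x δ : ℝ) (N : ℕ) :
    closePairCount (fun n => (a n : ℝ) * x) δ N = ∑ p ∈ (Finset.Icc 1 N).offDiag,
      nearIntIndicator δ ((((a p.1 : ℤ) - a p.2).natAbs : ℝ) * x) := by
  classical
  have hdist : ∀ p : ℕ × ℕ, distNearestInt ((((a p.1 : ℤ) - a p.2).natAbs : ℝ) * x) =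
      distNearestInt (a p.1 * x - a p.2 * x) := fun p => by
    rw [Nat.cast_natAbs, ← sub_mul]
    push_cast
    rcases abs_choice ((a p.1 : ℝ) - a p.2) with h | h <;> rw [h]
    rw [neg_mul, distNearestInt_neg]
  simp_rw [nearIntIndicator_apply, hdist]
  rw [Finset.sum_boole, closePairCount]
  congr 2
  ext p
  simp only [Finset.mem_filter, Finset.mem_product, Finset.mem_offDiag]
  tauto

theorem exists_integral_sq_closePairCount_sub_le {a : ℕ → ℕ} (ha : Set.InjOn a {n | 1 ≤ n})
    {ε : ℝ} (hε : 0 < ε) :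
    ∃ C : ℝ, 0 < C ∧ ∀ (N : ℕ) (δ : ℝ), 0 < N → 0 ≤ δ → δ ≤ 1 / 2 →
      ∫ x in (0 : ℝ)..1,
        (closePairCount (fun n => (a n : ℝ) * x) δ N - 2 * δ * ((N : ℝ) ^ 2 - N)) ^ 2 ≤
        C * δ * (N : ℝ) ^ (3 + ε) := by
  obtain ⟨C, hC, H⟩ := exists_sum_sum_gcd_div_max_le (half_pos hε)
  refine ⟨4 * C, by positivity, fun N δ hN h0 h1 => ?_⟩
  have hinj : Set.InjOn a (Finset.Icc 1 N : Finset ℕ) := ha.mono fun n hn => by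
    simpa using (Finset.mem_Icc.mp hn).1
  have hd : ∀ p ∈ (Finset.Icc 1 N).offDiag, 0 < ((a p.1 : ℤ) - a p.2).natAbs := by
    intro p hp
    obtain ⟨h1, h2, h3⟩ := Finset.mem_offDiag.mp hp
    have := mt (hinj h1 h2) h3
    omega
  have hcard : ((Finset.Icc 1 N).offDiag.card : ℝ) = (N : ℝ) ^ 2 - N := by
    rw [Finset.offDiag_card, Nat.card_Icc, add_tsub_cancel_right,
      Nat.cast_sub (Nat.le_mul_self N), Nat.cast_mul, sq]
  have hNR : (0 : ℝ) < N := by exact_mod_cast hN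
  have hcard' : ((Finset.Icc 1 N).offDiag.card : ℝ) ≤ (N : ℝ) ^ 2 := by rw [hcard]; linarith
  have hG := H _ _ (2 * N) hd fun m => by
    simpa using card_filter_natAbs_sub_eq_le hinj m
  have hV := integral_sq_sum_nearIntIndicator_sub_le h0 h1 _ _ hd
  rw [hcard] at hV
  simp_rw [closePairCount_natCast_mul]
  refine hV.trans ?_
  have h2 : ((N : ℝ) ^ 2) ^ (ε / 2) = (N : ℝ) ^ ε := by
    rw [← Real.rpow_two, ← Real.rpow_mul hNR.le]; congr 1; ring
  calc _ ≤ 2 * δ * (C * ((Finset.Icc 1 N).offDiag.card : ℝ) ^ (ε / 2) *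
          ((2 * N : ℕ) * (Finset.Icc 1 N).offDiag.card)) := by
        exact mul_le_mul_of_nonneg_left hG (by positivity)
    _ ≤ 2 * δ * (C * ((N : ℝ) ^ 2) ^ (ε / 2) * ((2 * N : ℕ) * (N : ℝ) ^ 2)) := by gcongr
    _ = _ := by
        rw [Real.rpow_add hNR, Real.rpow_ofNat, h2]; push_cast; ring

/-! ### Almost sure convergence along a sparse sequence -/

/-- By Tonelli a tail of the series of the `g j` has finite integral, so it converges almost
everywhere and its terms vanish in the limit. -/
theorem ae_tendsto_zero_of_summable_integral {g : ℕ → ℝ → ℝ} {c : ℕ → ℝ}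
    (hg0 : ∀ j x, 0 ≤ g j x) (hm : ∀ j, Measurable (g j))
    (hi : ∀ j, IntervalIntegrable (g j) volume 0 1) (hc : Summable c)
    (hle : ∀ᶠ j in atTop, ∫ x in (0 : ℝ)..1, g j x ≤ c j) :
    ∀ᵐ x ∂(volume.restrict (Set.Icc (0 : ℝ) 1)), Tendsto (fun j => g j x) atTop (𝓝 0) := by
  obtain ⟨J, hJ⟩ := eventually_atTop.mp hle
  set μ := (volume : Measure ℝ).restrict (Set.Icc (0 : ℝ) 1)
  have hint : ∀ j, Integrable (g j) μ := fun j =>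
    (intervalIntegrable_iff_integrableOn_Icc_of_le zero_le_one).mp (hi j)
  have hval : ∀ j, ∫⁻ x, ENNReal.ofReal (g j x) ∂μ =
      ENNReal.ofReal (∫ x in (0 : ℝ)..1, g j x) := fun j => by
    rw [← ofReal_integral_eq_lintegral_ofReal (hint j) (Eventually.of_forall (hg0 j)),
      intervalIntegral.integral_of_le zero_le_one, ← integral_Icc_eq_integral_Ioc]
  have hmeas : ∀ j, Measurable fun x => ENNReal.ofReal (g (j + J) x) := fun j =>
    (hm _).ennreal_ofReal
  have hfin : ∫⁻ x, ∑' j, ENNReal.ofReal (g (j + J) x) ∂μ ≠ ⊤ := by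
    rw [lintegral_tsum fun j => (hmeas j).aemeasurable]
    have hc' : Summable fun j => c (j + J) := (summable_nat_add_iff J).mpr hc
    refine ne_top_of_le_ne_top hc'.tsum_ofReal_ne_top (ENNReal.tsum_le_tsum fun j => ?_)
    rw [hval]
    exact ENNReal.ofReal_le_ofReal (hJ _ (Nat.le_add_left _ _))
  filter_upwards [ae_lt_top (Measurable.tsum hmeas) hfin] with x hx
  have h := ENNReal.tendsto_atTop_zero_of_tsum_ne_top hx.ne
  have h' := (ENNReal.continuousAt_toReal ENNReal.zero_ne_top).tendsto.comp h
  rw [← tendsto_add_atTop_iff_nat J]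
  simpa [Function.comp_def, ENNReal.toReal_ofReal (hg0 _ _)] using h'

theorem measurable_closePairCount (a : ℕ → ℕ) (δ : ℝ) (N : ℕ) :
    Measurable fun x : ℝ => closePairCount (fun n => (a n : ℝ) * x) δ N := by
  simp_rw [closePairCount_natCast_mul]
  have := measurable_nearIntIndicator δ
  fun_prop

theorem closePairCount_le (y : ℕ → ℝ) (δ : ℝ) (N : ℕ) : closePairCount y δ N ≤ (N : ℝ) ^ 2 := by
  unfold closePairCount
  have h := Finset.card_filter_le (Finset.Icc 1 N ×ˢ Finset.Icc 1 N) fun p : ℕ × ℕ =>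
    p.1 ≠ p.2 ∧ distNearestInt (y p.1 - y p.2) ≤ δ
  rw [Finset.card_product, Nat.card_Icc, add_tsub_cancel_right, ← sq] at h
  exact_mod_cast h

theorem intervalIntegrable_sq_pairCorrelation_sub (a : ℕ → ℕ) (β s c : ℝ) (N : ℕ) :
    IntervalIntegrable (fun x => (pairCorrelation (fun n => (a n : ℝ) * x) β s N - c) ^ 2)
      volume 0 1 := by
  simp_rw [pairCorrelation_eq]
  set δ := s / (N : ℝ) ^ β
  have hm := measurable_closePairCount a δ N
  refine (intervalIntegrable_const (c := ((N : ℝ) ^ 2 / (N : ℝ) ^ (2 - β) + |c|) ^ 2)).mono_fun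
    (((hm.div_const _).sub_const c).pow_const 2).aestronglyMeasurable
    (Eventually.of_forall fun x => ?_)
  have h1 := closePairCount_nonneg (fun n => (a n : ℝ) * x) δ N
  have h2 := closePairCount_le (fun n => (a n : ℝ) * x) δ N
  have hpos : (0 : ℝ) ≤ (N : ℝ) ^ (2 - β) := by positivity
  have h3 := div_nonneg h1 hpos
  have h4 := div_le_div_of_nonneg_right h2 hpos
  simp only [norm_pow, Real.norm_eq_abs]
  refine pow_le_pow_left₀ (abs_nonneg _) ?_ 2
  refine (norm_sub_le (E := ℝ) _ _).trans (le_trans ?_ (le_abs_self _))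
  simp only [Real.norm_eq_abs]
  rw [abs_of_nonneg h3]
  gcongr

theorem exists_integral_sq_pairCorrelation_sub_le {a : ℕ → ℕ} (ha : Set.InjOn a {n | 1 ≤ n})
    (β : ℝ) {ε : ℝ} (hε : 0 < ε) :
    ∃ C : ℝ, 0 < C ∧ ∀ (N : ℕ) (s : ℝ), 0 < N → 0 ≤ s → s / (N : ℝ) ^ β ≤ 1 / 2 →
      ∫ x in (0 : ℝ)..1,
        (pairCorrelation (fun n => (a n : ℝ) * x) β s N - 2 * s * (1 - (N : ℝ)⁻¹)) ^ 2 ≤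
        C * s * (N : ℝ) ^ (β - 1 + ε) := by
  obtain ⟨C, hC, H⟩ := exists_integral_sq_closePairCount_sub_le ha hε
  refine ⟨C, hC, fun N s hN hs hδ => ?_⟩
  have hNR : (0 : ℝ) < N := by exact_mod_cast hN
  have hsplit : (N : ℝ) ^ (2 : ℕ) = (N : ℝ) ^ (2 - β) * (N : ℝ) ^ β := by
    rw [← Real.rpow_add hNR, sub_add_cancel, Real.rpow_two]
  have hB : 0 < (N : ℝ) ^ β := by positivity
  have hB2 : 0 < (N : ℝ) ^ (2 - β) := by positivity
  have hpt : ∀ x : ℝ,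
      (pairCorrelation (fun n => (a n : ℝ) * x) β s N - 2 * s * (1 - (N : ℝ)⁻¹)) ^ 2 =
      ((N : ℝ) ^ (2 - β))⁻¹ ^ 2 * (closePairCount (fun n => (a n : ℝ) * x)
        (s / (N : ℝ) ^ β) N - 2 * (s / (N : ℝ) ^ β) * ((N : ℝ) ^ 2 - N)) ^ 2 := fun x => by
    have h1 : (N : ℝ) ^ 2 - N = (N : ℝ) ^ (2 - β) * (N : ℝ) ^ β * (1 - (N : ℝ)⁻¹) := by
      rw [← hsplit]; field_simp
    rw [pairCorrelation_eq, h1, ← mul_pow]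
    congr 1
    generalize closePairCount _ _ N = R
    field_simp
  simp_rw [hpt]
  rw [intervalIntegral.integral_const_mul]
  calc _ ≤ ((N : ℝ) ^ (2 - β))⁻¹ ^ 2 * (C * (s / (N : ℝ) ^ β) * (N : ℝ) ^ (3 + ε)) := by
        gcongr
        exact H N _ hN (by positivity) hδ
    _ = C * s * (((N : ℝ) ^ (2 - β))⁻¹ ^ 2 * ((N : ℝ) ^ β)⁻¹ * (N : ℝ) ^ (3 + ε)) := by
        ring
    _ = _ := by
        rw [← Real.rpow_neg hNR.le, ← Real.rpow_neg hNR.le, ← Real.rpow_natCast,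
          ← Real.rpow_mul hNR.le, ← Real.rpow_add hNR, ← Real.rpow_add hNR]
        -- Exponent count: `-2 (2 - β) - β + 3 + ε = β - 1 + ε`.
        congr 2; push_cast; ring

theorem eventually_atTop_of_eventually_bracket {u : ℕ → ℕ} (hu : StrictMono u) {p : ℕ → Prop}
    (h : ∀ᶠ j in atTop, ∀ N, u j ≤ N → N ≤ u (j + 1) → p N) : ∀ᶠ N in atTop, p N := by
  obtain ⟨J, hJ⟩ := eventually_atTop.mp h
  filter_upwards [eventually_ge_atTop (u J)] with N hN
  have hex : ∃ k, N < u k := ⟨N + 1, (Nat.lt_succ_self N).trans_le (hu.le_apply)⟩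
  classical
  have hk := Nat.find_spec hex
  have hJk : J < Nat.find hex := hu.lt_iff_lt.mp (hN.trans_lt hk)
  obtain ⟨j, hj⟩ := Nat.exists_eq_succ_of_ne_zero (Nat.ne_zero_of_lt hJk)
  rw [hj] at hk hJk
  exact hJ j (Nat.lt_succ_iff.mp hJk) N
    (not_lt.mp (Nat.find_min hex (by omega))) hk.le

/-- For `u j ≤ N ≤ u (j + 1)` the count is squeezed between those at the endpoints, with rational
`q` slightly below or above `s` absorbing the change of `N ^ β`. As the endpoint ratio tends to `1`,
the normalisation is unaffected in the limit. -/
theorem tendsto_pairCorrelation_of_subsequence {y : ℕ → ℝ} {β : ℝ} (hβ0 : 0 < β) (hβ2 : β < 2)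
    {u : ℕ → ℕ} (hu : StrictMono u) (hu0 : ∀ j, 0 < u j)
    (hratio : Tendsto (fun j => (u (j + 1) : ℝ) / u j) atTop (𝓝 1))
    (h : ∀ q : ℚ, 0 < q →
      Tendsto (fun j => pairCorrelation y β q (u j)) atTop (𝓝 (2 * q))) :
    HasPoissonianPairCorrelations β y := by
  intro s hs
  have hγ : 0 < 2 - β := by linarith
  have hpow : ∀ γ : ℝ,
      Tendsto (fun j => ((u (j + 1) : ℝ) / u j) ^ γ) atTop (𝓝 1) := fun γ => by
    simpa using hratio.rpow_const (p := γ) (Or.inl one_ne_zero)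
  have hpos : ∀ j, (0 : ℝ) < u j := fun j => by exact_mod_cast hu0 j
  refine tendsto_order.mpr ⟨fun c hc => ?_, fun c hc => ?_⟩
  -- The maximum with `0` keeps `q` positive when `c` is negative.
  · obtain ⟨q, hq1, hq2⟩ := exists_rat_btwn (show max 0 (c / 2) < s from max_lt hs (by linarith))
    obtain ⟨hq0, hqc⟩ := max_lt_iff.mp hq1
    have hlim := (h q (by exact_mod_cast hq0)).div (hpow (2 - β)) one_ne_zero
    have hlim2 := (hpow β).const_mul (q : ℝ)
    rw [div_one] at hlim
    rw [mul_one] at hlim2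
    refine eventually_atTop_of_eventually_bracket hu ?_
    filter_upwards [hlim.eventually_const_lt (show c < 2 * (q : ℝ) by linarith),
      hlim2.eventually_lt_const hq2] with j h1 h2 N hN1 hN2
    have hN0 : (0 : ℝ) < N := (hpos j).trans_le (by exact_mod_cast hN1)
    refine h1.trans_le ?_
    simp only [Pi.div_apply]
    have hB : 0 < (u j : ℝ) ^ (2 - β) := Real.rpow_pos_of_pos (hpos j) _
    have hB' : 0 < (u (j + 1) : ℝ) ^ (2 - β) := Real.rpow_pos_of_pos (hpos (j + 1)) _
    rw [pairCorrelation_eq, pairCorrelation_eq, Real.div_rpow (hpos _).le (hpos _).le,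
      div_div, mul_div_cancel₀ _ hB.ne']
    have hδ : (q : ℝ) / (u j : ℝ) ^ β ≤ s / (N : ℝ) ^ β := by
      rw [Real.div_rpow (hpos _).le (hpos _).le] at h2
      have b1 : 0 < (u j : ℝ) ^ β := Real.rpow_pos_of_pos (hpos j) _
      have b2 : 0 < (N : ℝ) ^ β := Real.rpow_pos_of_pos hN0 _
      have b3 : (N : ℝ) ^ β ≤ (u (j + 1) : ℝ) ^ β := by gcongr
      rw [div_le_div_iff₀ b1 b2]
      rw [← mul_div_assoc, div_lt_iff₀ b1] at h2
      nlinarith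
    have hc := closePairCount_mono y hδ hN1
    calc _ ≤ closePairCount y (s / (N : ℝ) ^ β) N / (u (j + 1) : ℝ) ^ (2 - β) := by gcongr
      _ ≤ _ := by
        have := closePairCount_nonneg y (s / (N : ℝ) ^ β) N
        gcongr
  · obtain ⟨q, hq1, hq2⟩ := exists_rat_btwn (show s < c / 2 by linarith)
    have hq0 : (0 : ℝ) < q := hs.trans hq1
    have hlim := (((tendsto_add_atTop_iff_nat 1).mpr (h q (by exact_mod_cast hq0)))).mul
      (hpow (2 - β))
    have hlim2 := (hpow β).const_mul s
    rw [mul_one] at hlim hlim2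
    refine eventually_atTop_of_eventually_bracket hu ?_
    filter_upwards [hlim.eventually_lt_const (show 2 * (q : ℝ) < c by linarith),
      hlim2.eventually_lt_const hq1] with j h1 h2 N hN1 hN2
    have hN0 : (0 : ℝ) < N := (hpos j).trans_le (by exact_mod_cast hN1)
    refine lt_of_le_of_lt ?_ h1
    have hB : 0 < (u j : ℝ) ^ (2 - β) := Real.rpow_pos_of_pos (hpos j) _
    have hB' : 0 < (u (j + 1) : ℝ) ^ (2 - β) := Real.rpow_pos_of_pos (hpos (j + 1)) _
    rw [pairCorrelation_eq, pairCorrelation_eq, Real.div_rpow (hpos _).le (hpos _).le,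
      div_mul_div_cancel₀ hB'.ne']
    have hδ : s / (N : ℝ) ^ β ≤ q / (u (j + 1) : ℝ) ^ β := by
      rw [Real.div_rpow (hpos _).le (hpos _).le] at h2
      have b1 : 0 < (u j : ℝ) ^ β := Real.rpow_pos_of_pos (hpos j) _
      have b0 : 0 < (u (j + 1) : ℝ) ^ β := Real.rpow_pos_of_pos (hpos (j + 1)) _
      have b2 : 0 < (N : ℝ) ^ β := Real.rpow_pos_of_pos hN0 _
      have b3 : (u j : ℝ) ^ β ≤ (N : ℝ) ^ β := by gcongr
      rw [div_le_div_iff₀ b2 b0]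
      rw [← mul_div_assoc, div_lt_iff₀ b1] at h2
      nlinarith
    have hc := closePairCount_mono y hδ hN2
    calc _ ≤ closePairCount y (q / (u (j + 1) : ℝ) ^ β) (u (j + 1)) / (N : ℝ) ^ (2 - β) := by
          gcongr
      _ ≤ _ := by
        have := closePairCount_nonneg y (q / (u (j + 1) : ℝ) ^ β) (u (j + 1))
        gcongr

theorem ae_tendsto_pairCorrelation_pow {a : ℕ → ℕ} (ha : Set.InjOn a {n | 1 ≤ n}) {β : ℝ}
    (hβ0 : 0 < β) (hβ1 : β < 1) {L : ℕ} (hL : 4 ≤ L * (1 - β)) {s : ℝ} (hs : 0 < s) :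
    ∀ᵐ x ∂(volume.restrict (Set.Icc (0 : ℝ) 1)),
      Tendsto (fun j : ℕ => pairCorrelation (fun n => (a n : ℝ) * x) β s ((j + 1) ^ L)) atTop
        (𝓝 (2 * s)) := by
  -- With `ε = (1 - β) / 2` the variance is `O(N ^ (-(1 - β) / 2))`; since `L (1 - β) ≥ 4`, at `N =
  -- (j + 1) ^ L` this is `O((j + 1) ^ (-2))`.
  obtain ⟨C, hC, H⟩ := exists_integral_sq_pairCorrelation_sub_le ha β
    (show 0 < (1 - β) / 2 by linarith)
  have hL0 : L ≠ 0 := by rintro rfl; norm_num at hL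
  have hN : Tendsto (fun j : ℕ => (((j + 1) ^ L : ℕ) : ℝ)) atTop atTop :=
    tendsto_natCast_atTop_atTop.comp ((tendsto_pow_atTop hL0).comp (tendsto_add_atTop_nat 1))
  have hmean : Tendsto (fun j : ℕ => 2 * s * (1 - ((((j + 1) ^ L : ℕ) : ℝ))⁻¹)) atTop
      (𝓝 (2 * s)) := by
    simpa using ((tendsto_inv_atTop_zero.comp hN).const_sub 1).const_mul (2 * s)
  have hsum : Summable fun j : ℕ => C * s * (1 / ((j + 1 : ℕ) : ℝ) ^ (2 : ℕ)) :=
    ((summable_nat_add_iff 1).mpr (Real.summable_one_div_nat_pow.mpr one_lt_two)).mul_left _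
  have hδ : ∀ᶠ j : ℕ in atTop, s / (((j + 1) ^ L : ℕ) : ℝ) ^ β ≤ 1 / 2 :=
    ((tendsto_const_nhds.div_atTop ((tendsto_rpow_atTop hβ0).comp hN)).eventually_le_const
      (by norm_num))
  have hae := ae_tendsto_zero_of_summable_integral
    (g := fun j x => (pairCorrelation (fun n => (a n : ℝ) * x) β s ((j + 1) ^ L) -
      2 * s * (1 - ((((j + 1) ^ L : ℕ) : ℝ))⁻¹)) ^ 2)
    (fun _ _ => sq_nonneg _)
    (fun j => by
      simp_rw [pairCorrelation_eq]
      exact (((measurable_closePairCount a _ _).div_const _).sub_const _).pow_const 2)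
    (fun j => intervalIntegrable_sq_pairCorrelation_sub a β s _ _) hsum
    (by
      filter_upwards [hδ] with j hj
      refine (H _ s (by positivity) hs.le hj).trans ?_
      refine mul_le_mul_of_nonneg_left ?_ (by positivity)
      have h1 : (1 : ℝ) ≤ ((j + 1 : ℕ) : ℝ) := by exact_mod_cast Nat.le_add_left 1 j
      rw [Nat.cast_pow, ← Real.rpow_natCast, ← Real.rpow_mul (by positivity), one_div,
        ← Real.rpow_natCast, ← Real.rpow_neg (by positivity)]
      refine Real.rpow_le_rpow_of_exponent_le h1 ?_
      push_cast
      linarith)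
  filter_upwards [hae] with x hx
  have h := hx.sqrt
  simp only [Real.sqrt_sq_eq_abs, Real.sqrt_zero] at h
  simpa using ((tendsto_zero_iff_abs_tendsto_zero _).mpr h).add hmean

theorem tendsto_succ_pow_div (L : ℕ) :
    Tendsto (fun j : ℕ => (((j + 1 + 1) ^ L : ℕ) : ℝ) / (((j + 1) ^ L : ℕ) : ℝ)) atTop (𝓝 1) := by
  have h : Tendsto (fun j : ℕ => (1 + 1 / ((j : ℝ) + 1)) ^ L) atTop (𝓝 1) := by
    simpa using (tendsto_one_div_add_atTop_nhds_zero_nat.const_add (1 : ℝ)).pow L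
  refine h.congr fun j => ?_
  push_cast
  rw [← div_pow]
  congr 1
  field_simp

theorem theorem6 (a : ℕ → ℕ) (ha_pos : ∀ n, 1 ≤ n → 0 < a n)
    (ha_incr : ∀ m n, 1 ≤ m → m < n → a m < a n)
    (β : ℝ) (hβ_pos : 0 < β) (hβ_lt : β < 1) :
    ∀ᵐ x : ℝ ∂(volume.restrict (Set.Icc (0 : ℝ) 1)),
      HasPoissonianPairCorrelations β (fun n => (a n : ℝ) * x) := by
  have ha : Set.InjOn a {n | 1 ≤ n} := by
    have : StrictMonoOn a {n | 1 ≤ n} := fun m hm n _ hmn => ha_incr m n hm hmn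
    exact this.injOn
  obtain ⟨L, hL⟩ := exists_nat_ge (4 / (1 - β))
  rw [div_le_iff₀ (by linarith)] at hL
  have hL0 : L ≠ 0 := by rintro rfl; norm_num at hL
  -- Restricting to rational `q` leaves only countably many null sets to discard.
  have hae : ∀ᵐ x ∂(volume.restrict (Set.Icc (0 : ℝ) 1)), ∀ q : ℚ, 0 < q →
      Tendsto (fun j : ℕ => pairCorrelation (fun n => (a n : ℝ) * x) β q ((j + 1) ^ L)) atTop
        (𝓝 (2 * q)) :=
    ae_all_iff.mpr fun q => Filter.eventually_imp_distrib_left.mpr fun hq =>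
      ae_tendsto_pairCorrelation_pow ha hβ_pos hβ_lt hL (by exact_mod_cast hq)
  filter_upwards [hae] with x hx
  refine tendsto_pairCorrelation_of_subsequence hβ_pos (by linarith)
    (u := fun j => (j + 1) ^ L) (fun i j hij => ?_) (fun j => by positivity)
    (tendsto_succ_pow_div L) hx
  exact Nat.pow_lt_pow_left (by omega) hL0
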